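/- Let $\|\cdot\|$ be a norm on the plane $\mathbb R^2$ that is smooth, i.e. $x\mapsto\|x\|$ is differentiable at every $x\neq 0$ (the norm is not assumed to be strictly convex), and let $p_0,p_1\in\mathbb R^2$ be two distinct points. For $x\in\mathbb R^2$ and $A\subseteq\mathbb R^2$ put $\mathrm{dist}(x,A)=\inf_{a\in A}\|x-a\|\in[0,+\infty]$ (so $\mathrm{dist}(x,\emptyset)=+\infty$). Then the point sites $P_0=\{p_0\}$ and $P_1=\{p_1\}$ have exactly one zone diagram; that is, there is exactly one pair $(R_0,R_1)$ of subsets of $\mathbb R^2$ such that $$R_0=\{x\in\mathbb R^2:\ \|x-p_0\|\le \mathrm{dist}(x,R_1)\}\quad\text{and}\quad R_1=\{x\in\mathbb R^2:\ \|x-p_1\|\le \mathrm{dist}(x,R_0)\}.$$ -/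

import Mathlib

/-- The dominance region of `A` over `B`: all points `x` with `dist(x, A) ≤ dist(x, B)`. Distances
to sets are infima in `[0, ∞]`, so the distance to the empty set is `∞`. -/
def dominance {X : Type*} [MetricSpace X] (A B : Set X) : Set X :=
  {x | Metric.infEDist x A ≤ Metric.infEDist x B}

/-- The operator sending a tuple `R` to the tuple whose `i`-th entry is the dominance region of
the site `P i` over the union of all the `R j` with `j ≠ i`. -/
def Dom {X ι : Type*} [MetricSpace X] (P R : ι → Set X) : ι → Set X :=
  fun i => dominance (P i) (⋃ j ∈ {j : ι | j ≠ i}, R j)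

/-- `R` is a zone diagram of the tuple of sites `P` if it is a fixed point of `Dom`. -/
def IsZoneDiagram {X ι : Type*} [MetricSpace X] (P R : ι → Set X) : Prop :=
  R = Dom P R

/-- The norm of `E` is smooth: it is differentiable at every nonzero vector. -/
def SmoothNorm (E : Type*) [NormedAddCommGroup E] [NormedSpace ℝ E] : Prop :=
  ∀ x : E, x ≠ 0 → DifferentiableAt ℝ (fun y : E => ‖y‖) x

/-! Composing the two dominance operators gives a monotone map whose least and greatest fixed points
enclose every zone diagram, so existence and uniqueness both reduce to `IsSandwich.lower_eq_upper`.
If the lower and upper regions differ, let m > 0 be the infimum of the distances from a site to its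
discrepancy. A gap of relative length s on a ray from one site forces one of relative length σ on a
ray from the other (`IsSandwich.exists_step`), and near distance m the ratio σ / s cannot stay below
1 (`SmoothNorm.exists_forall_gapStep`). Starting from almost maximal s, two consecutive steps have
ratios tending to 1. Compactness yields limits with α - P, α - β, β - Q, β - γ, γ - P all of norm m.
The first step makes the derivative of the norm at α - β vanish on α - P; the second gives ‖β - P‖ =
2m, so α lies on a metric segment from β to P. By smoothness the functional norming β - α also norms
α - P, whence m = 0. -/

open Filter Topology

/-! ### Slopes and norming functionals of the norm -/

/-- Secant slopes of the norm increase along a line. -/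
theorem norm_sub_norm_sub_smul_le {E : Type*} [NormedAddCommGroup E] [NormedSpace ℝ E]
    (x v : E) {s t : ℝ} (hs : 0 ≤ s) (ht : 0 < t) :
    ‖x‖ - ‖x - s • v‖ ≤ s * ((‖x + t • v‖ - ‖x‖) / t) := by
  have h : ‖(s + t) • x‖ ≤ t * ‖x - s • v‖ + s * ‖x + t • v‖ := by
    have e : (s + t) • x = t • (x - s • v) + s • (x + t • v) := by module
    rw [e]
    refine (norm_add_le _ _).trans_eq ?_
    rw [norm_smul_of_nonneg ht.le, norm_smul_of_nonneg hs]
  rw [norm_smul_of_nonneg (by positivity)] at h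
  rw [mul_div_assoc', le_div_iff₀ ht]
  linarith

theorem tendsto_norm_slope {E : Type*} [NormedAddCommGroup E] [NormedSpace ℝ E] {x : E}
    (hx : DifferentiableAt ℝ (fun y : E => ‖y‖) x) (v : E) :
    Tendsto (fun t : ℝ => (‖x + t • v‖ - ‖x‖) / t) (𝓝[>] 0)
      (𝓝 (fderiv ℝ (fun y : E => ‖y‖) x v)) := by
  have h := (hx.hasFDerivAt.hasLineDerivAt v).tendsto_slope_zero_right
  refine h.congr fun t => ?_
  simp [div_eq_inv_mul]

theorem abs_fderiv_norm_le {E : Type*} [NormedAddCommGroup E] [NormedSpace ℝ E] (x v : E) :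
    |fderiv ℝ (fun y : E => ‖y‖) x v| ≤ ‖v‖ := by
  have h : ‖fderiv ℝ (fun y : E => ‖y‖) x‖ ≤ 1 :=
    NNReal.coe_one ▸ norm_fderiv_le_of_lipschitz ℝ lipschitzWith_one_norm
  simpa using (fderiv ℝ (fun y : E => ‖y‖) x).le_of_opNorm_le h v

/-- At a point of differentiability of the norm the norming functional is unique. -/
theorem eq_fderiv_norm_of_norming {E : Type*} [NormedAddCommGroup E] [NormedSpace ℝ E] {x : E}
    (hx : DifferentiableAt ℝ (fun y : E => ‖y‖) x) (f : E →L[ℝ] ℝ) (hf : ∀ y, f y ≤ ‖y‖)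
    (hfx : f x = ‖x‖) : f = fderiv ℝ (fun y : E => ‖y‖) x := by
  have hmin : IsLocalMin (fun y : E => ‖y‖ - f y) x :=
    Eventually.of_forall fun y => by simpa [hfx] using hf y
  have h0 := hmin.hasFDerivAt_eq_zero (hx.hasFDerivAt.sub f.hasFDerivAt)
  exact (sub_eq_zero.1 h0).symm

theorem fderiv_norm_neg {E : Type*} [NormedAddCommGroup E] [NormedSpace ℝ E] (x : E) :
    fderiv ℝ (fun y : E => ‖y‖) (-x) = -fderiv ℝ (fun y : E => ‖y‖) x := by
  simpa using fderiv_norm_smul_neg (E := E) (x := x) (t := -1) (by norm_num)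

/-- In a smooth norm, if `x` and `y` span a metric segment then the norming functional of `x` is
norming for `y`. -/
theorem SmoothNorm.fderiv_norm_eq_of_norm_add {E : Type*} [NormedAddCommGroup E]
    [NormedSpace ℝ E] (hE : SmoothNorm E) {x y : E} (hx : x ≠ 0) (h : ‖x‖ + ‖y‖ ≤ ‖x + y‖) :
    fderiv ℝ (fun z : E => ‖z‖) x y = ‖y‖ := by
  have hxy : x + y ≠ 0 := by
    rw [← norm_pos_iff]
    have := norm_pos_iff.2 hx
    have := norm_nonneg y
    linarith
  -- A functional norming x + y must norm both summands; uniqueness at x identifies it.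
  set f := fderiv ℝ (fun z : E => ‖z‖) (x + y)
  have hf : ∀ z, f z ≤ ‖z‖ := fun z => (le_abs_self _).trans (abs_fderiv_norm_le _ z)
  have hself : f (x + y) = ‖x + y‖ := (hE _ hxy).fderiv_norm_self
  rw [map_add] at hself
  have h1 := hf x
  have h2 := hf y
  rw [← eq_fderiv_norm_of_norming (hE x hx) f hf (by linarith)]
  linarith

/-! ### Gap steps and their limits -/

/-- The metric data of one step from a gap on a ray from `p` to a gap on a ray from `q`: the gaps
are the segments from `a` to `a + s • (a - p)` and from `b` to `b + σ • (b - q)`. -/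
structure GapStep {E : Type*} [NormedAddCommGroup E] [NormedSpace ℝ E]
    (m : ℝ) (p a : E) (s : ℝ) (q b : E) (σ : ℝ) : Prop where
  pos : 0 < s
  nonneg : 0 ≤ σ
  le_source : m ≤ ‖a - p‖
  le_target : m ≤ ‖b - q‖
  dist_eq : ‖a - (b + σ • (b - q))‖ = ‖a - p‖
  target_le : (1 + σ) * ‖b - q‖ ≤ ‖a - p‖
  le_segment : ∀ t ∈ Set.Icc (0 : ℝ) 1, m ≤ ‖a + t • (p - a) - (b + σ • (b - q))‖
  source_le : (1 + s) * ‖a - p‖ ≤ ‖a + s • (a - p) - b‖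

/-- With a' = a + s(a - p) and b' = b + σ(b - q), the fields give s‖a - p‖ ≤ ‖a' - b‖ - ‖a - b'‖.
Inserting ‖a' - b'‖ splits this into a move along b - q and one along a - p, each bounded by a
secant slope. -/
theorem GapStep.slope_le {E : Type*} [NormedAddCommGroup E] [NormedSpace ℝ E]
    {m : ℝ} {p a : E} {s : ℝ} {q b : E} {σ : ℝ} (h : GapStep m p a s q b σ) {ρ t : ℝ}
    (hρ : σ ≤ ρ * s) (ht : 0 < t) :
    m ≤ ρ * max ((‖a + s • (a - p) - b + t • (b - q)‖ - ‖a + s • (a - p) - b‖) / t) 0 +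
      (‖a + s • (a - p) - (b + σ • (b - q)) + t • (a - p)‖ -
        ‖a + s • (a - p) - (b + σ • (b - q))‖) / t := by
  have h1 := norm_sub_norm_sub_smul_le (a + s • (a - p) - b) (b - q) h.nonneg ht
  have h2 := norm_sub_norm_sub_smul_le (a + s • (a - p) - (b + σ • (b - q))) (a - p) h.pos.le ht
  set A := (‖a + s • (a - p) - b + t • (b - q)‖ - ‖a + s • (a - p) - b‖) / t
  set B := (‖a + s • (a - p) - (b + σ • (b - q)) + t • (a - p)‖ -
        ‖a + s • (a - p) - (b + σ • (b - q))‖) / t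
  have e1 : a + s • (a - p) - b - σ • (b - q) = a + s • (a - p) - (b + σ • (b - q)) := by module
  have e2 : a + s • (a - p) - (b + σ • (b - q)) - s • (a - p) = a - (b + σ • (b - q)) := by module
  rw [e1] at h1
  rw [e2, h.dist_eq] at h2
  have h3 := h.source_le
  have h4 : σ * A ≤ ρ * s * max A 0 :=
    (mul_le_mul_of_nonneg_left (le_max_left A 0) h.nonneg).trans
      (mul_le_mul_of_nonneg_right hρ (le_max_right A 0))
  have h5 : s * m ≤ s * ‖a - p‖ := mul_le_mul_of_nonneg_left h.le_source h.pos.le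
  have h6 : s * m ≤ s * (ρ * max A 0 + B) := by linarith
  exact le_of_mul_le_mul_left h6 h.pos

/-- Limits of gap steps whose source distance approaches the lower bound `m`. -/
theorem GapStep.limit {E : Type*} [NormedAddCommGroup E] [NormedSpace ℝ E] (hE : SmoothNorm E)
    {ι : Type*} {l : Filter ι} [l.NeBot] {m : ℝ} (hm : 0 < m) {p a q b : ι → E}
    {s σ ρ ε : ι → ℝ} (h : ∀ n, GapStep m (p n) (a n) (s n) (q n) (b n) (σ n))
    (hle : ∀ n, (1 + s n) * ‖a n - p n‖ ≤ m + ε n) (hε : Tendsto ε l (𝓝 0))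
    {P Q α β : E} {r : ℝ} (hp : Tendsto p l (𝓝 P)) (hq : Tendsto q l (𝓝 Q))
    (ha : Tendsto a l (𝓝 α)) (hb : Tendsto b l (𝓝 β))
    (hσρ : ∀ n, σ n ≤ ρ n * s n) (hρ : Tendsto ρ l (𝓝 r)) :
    ‖α - P‖ = m ∧ ‖α - β‖ = m ∧ ‖β - Q‖ = m ∧
      fderiv ℝ (fun y : E => ‖y‖) (α - β) (α - P) ≤ 0 ∧
      m ≤ r * max (fderiv ℝ (fun y : E => ‖y‖) (α - β) (β - Q)) 0 +
        fderiv ℝ (fun y : E => ‖y‖) (α - β) (α - P) := by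
  have hsm : ∀ n, s n * m ≤ ε n := fun n => by
    have h1 := (h n).le_source
    have h2 := mul_le_mul_of_nonneg_left h1 (h n).pos.le
    have h3 := hle n
    linarith
  have hap : ∀ n, ‖a n - p n‖ ≤ m + ε n := fun n => by
    have h2 := mul_nonneg (h n).pos.le (norm_nonneg (a n - p n))
    have h3 := hle n
    linarith
  have hσm : ∀ n, σ n * m ≤ ε n := fun n => by
    have h1 := (h n).le_target
    have h2 := mul_le_mul_of_nonneg_left h1 (h n).nonneg
    have h3 := (h n).target_le
    have h4 := hap n
    linarith
  have hε' : Tendsto (fun n => ε n / m) l (𝓝 0) := by simpa using hε.div_const m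
  have hs : Tendsto s l (𝓝 0) := squeeze_zero (fun n => (h n).pos.le)
    (fun n => (le_div_iff₀ hm).2 (hsm n)) hε'
  have hσ : Tendsto σ l (𝓝 0) := squeeze_zero (fun n => (h n).nonneg)
    (fun n => (le_div_iff₀ hm).2 (hσm n)) hε'
  have hmε : Tendsto (fun n => m + ε n) l (𝓝 m) := by simpa using hε.const_add m
  have ha' : Tendsto (fun n => a n + s n • (a n - p n)) l (𝓝 α) := by
    simpa using ha.add (hs.smul (ha.sub hp))
  have hb' : Tendsto (fun n => b n + σ n • (b n - q n)) l (𝓝 β) := by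
    simpa using hb.add (hσ.smul (hb.sub hq))
  have hαP : ‖α - P‖ = m := tendsto_nhds_unique (ha.sub hp).norm
    (tendsto_of_tendsto_of_tendsto_of_le_of_le tendsto_const_nhds hmε
      (fun n => (h n).le_source) hap)
  have hαβ : ‖α - β‖ = m := by
    refine (tendsto_nhds_unique (ha.sub hb').norm ?_).trans hαP
    exact (ha.sub hp).norm.congr fun n => (h n).dist_eq.symm
  have hβQ : ‖β - Q‖ = m := by
    refine tendsto_nhds_unique (hb.sub hq).norm
      (tendsto_of_tendsto_of_tendsto_of_le_of_le tendsto_const_nhds hmε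
        (fun n => (h n).le_target) fun n => ?_)
    have h2 := mul_nonneg (h n).nonneg (norm_nonneg (b n - q n))
    have h3 := (h n).target_le
    have h4 := hap n
    change ‖b n - q n‖ ≤ m + ε n
    linarith
  have hne : α - β ≠ 0 := by
    rw [← norm_pos_iff, hαβ]; exact hm
  have hd := hE _ hne
  refine ⟨hαP, hαβ, hβQ, ?_, ?_⟩
  -- The segment from α to P stays at distance at least m from β; linearity of the derivative turns
  -- this into the sign for α - P.
  · have h0 : 0 ≤ fderiv ℝ (fun y : E => ‖y‖) (α - β) (P - α) := by
      refine ge_of_tendsto (tendsto_norm_slope hd (P - α)) ?_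
      filter_upwards [Ioc_mem_nhdsGT (zero_lt_one' ℝ)] with t ht
      have hlim : Tendsto (fun n => ‖a n + t • (p n - a n) - (b n + σ n • (b n - q n))‖) l
          (𝓝 ‖α + t • (P - α) - β‖) := ((ha.add ((hp.sub ha).const_smul t)).sub hb').norm
      have h1 : m ≤ ‖α + t • (P - α) - β‖ :=
        ge_of_tendsto hlim (Eventually.of_forall fun n => (h n).le_segment t ⟨ht.1.le, ht.2⟩)
      refine div_nonneg ?_ ht.1.le
      have e : α - β + t • (P - α) = α + t • (P - α) - β := by abel
      rw [e, hαβ]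
      linarith
    rw [← neg_sub α P, map_neg] at h0
    linarith
  · have hlim := (((tendsto_norm_slope hd (β - Q)).max
      (tendsto_const_nhds (x := (0 : ℝ)))).const_mul r).add (tendsto_norm_slope hd (α - P))
    refine ge_of_tendsto hlim ?_
    filter_upwards [self_mem_nhdsWithin] with t ht
    have hx := ha'.sub hb
    have hy := ha'.sub hb'
    have h1 := ((hx.add ((hb.sub hq).const_smul t)).norm.sub hx.norm).div_const t
    have h2 := ((hy.add ((ha.sub hp).const_smul t)).norm.sub hy.norm).div_const t
    exact ge_of_tendsto ((hρ.mul (h1.max tendsto_const_nhds)).add h2)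
      (Eventually.of_forall fun n => (h n).slope_le (hσρ n) ht)

/-- A fixed ultrafilter gives all the limits at once, without successive subsequences. -/
theorem exists_tendsto_hyperfilter {E : Type*} [NormedAddCommGroup E] [ProperSpace E]
    {u : ℕ → E} {c : E} {C : ℝ} (hu : ∀ n, ‖u n - c‖ ≤ C) :
    ∃ x, Tendsto u (hyperfilter ℕ : Filter ℕ) (𝓝 x) := by
  obtain ⟨x, -, hx⟩ := isCompact_iff_ultrafilter_le_nhds'.1 (isCompact_closedBall c C)
    ((hyperfilter ℕ).map u) (Ultrafilter.mem_map.2 (univ_mem' fun n => by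
      simpa [dist_eq_norm] using hu n))
  exact ⟨x, hx⟩

/-! ### Sandwiches and gaps on rays -/

/-- A lower and an upper pair of regions around the points `p i`, each the dominance regions
against the other. -/
structure IsSandwich {E : Type*} [NormedAddCommGroup E]
    (p : Bool → E) (R S : Bool → Set E) : Prop where
  ne : ∀ i, p i ≠ p (!i)
  mem_lower : ∀ i x, x ∈ R i ↔ ∀ b ∈ S (!i), ‖x - p i‖ ≤ ‖x - b‖
  mem_upper : ∀ i x, x ∈ S i ↔ ∀ b ∈ R (!i), ‖x - p i‖ ≤ ‖x - b‖
  subset : ∀ i, R i ⊆ S i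

theorem isClosed_setOf_norm_sub_le {E : Type*} [NormedAddCommGroup E] (p : E) (B : Set E) :
    IsClosed {x : E | ∀ b ∈ B, ‖x - p‖ ≤ ‖x - b‖} := by
  simp only [Set.ofPred_forall]
  exact isClosed_biInter fun b _ => isClosed_le (by fun_prop) (by fun_prop)

theorem norm_sub_le_of_star {E : Type*} [NormedAddCommGroup E] [NormedSpace ℝ E] {p x b : E}
    (h : ‖x - p‖ ≤ ‖x - b‖) {t : ℝ} (ht : t ∈ Set.Icc (0 : ℝ) 1) :
    ‖p + t • (x - p) - p‖ ≤ ‖p + t • (x - p) - b‖ := by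
  have h1 : ‖x - b‖ ≤ ‖(1 - t) • (x - p)‖ + ‖p + t • (x - p) - b‖ := by
    refine le_of_eq_of_le ?_ (norm_add_le _ _)
    congr 1
    module
  rw [norm_smul_of_nonneg (sub_nonneg.2 ht.2)] at h1
  rw [add_sub_cancel_left, norm_smul_of_nonneg ht.1]
  linarith

namespace IsSandwich

variable {E : Type*} [NormedAddCommGroup E] {p : Bool → E} {R S : Bool → Set E}

theorem isClosed_lower (h : IsSandwich p R S) (i : Bool) : IsClosed (R i) := by
  rw [show R i = {x | ∀ b ∈ S (!i), ‖x - p i‖ ≤ ‖x - b‖} from Set.ext (h.mem_lower i)]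
  exact isClosed_setOf_norm_sub_le _ _

theorem isClosed_upper (h : IsSandwich p R S) (i : Bool) : IsClosed (S i) := by
  rw [show S i = {x | ∀ b ∈ R (!i), ‖x - p i‖ ≤ ‖x - b‖} from Set.ext (h.mem_upper i)]
  exact isClosed_setOf_norm_sub_le _ _

theorem site_mem_lower (h : IsSandwich p R S) (i : Bool) : p i ∈ R i :=
  (h.mem_lower i _).2 fun b _ => by simp

theorem site_notMem_upper (h : IsSandwich p R S) (i : Bool) : p i ∉ S (!i) := fun hi => by
  have h1 := (h.mem_upper (!i) (p i)).1 hi (p i) (by simpa using h.site_mem_lower i)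
  rw [sub_self, norm_zero, norm_le_zero_iff, sub_eq_zero] at h1
  exact h.ne i h1

/-- A ball around the site misses the opposite upper region, so the ball of half the radius lies in
the lower region. -/
theorem exists_pos_le (h : IsSandwich p R S) (i : Bool) :
    ∃ δ > 0, ∀ x, x ∉ R i → δ ≤ ‖x - p i‖ := by
  obtain ⟨δ, hδ, hball⟩ := Metric.isOpen_iff.1 (h.isClosed_upper (!i)).isOpen_compl (p i)
    (h.site_notMem_upper i)
  refine ⟨δ / 2, by positivity, fun x hx => ?_⟩
  by_contra! hlt
  refine hx ((h.mem_lower i x).2 fun b hb => ?_)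
  have h1 : δ ≤ ‖b - p i‖ := by
    by_contra! hb'
    exact hball (by simpa [dist_eq_norm] using hb') hb
  have h2 := norm_sub_le_norm_sub_add_norm_sub b x (p i)
  rw [norm_sub_rev b x] at h2
  linarith

variable [NormedSpace ℝ E]

theorem star_lower (h : IsSandwich p R S) {i : Bool} {x : E} (hx : x ∈ R i) {t : ℝ}
    (ht : t ∈ Set.Icc (0 : ℝ) 1) : p i + t • (x - p i) ∈ R i :=
  (h.mem_lower i _).2 fun b hb => norm_sub_le_of_star ((h.mem_lower i x).1 hx b hb) ht

theorem star_upper (h : IsSandwich p R S) {i : Bool} {x : E} (hx : x ∈ S i) {t : ℝ}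
    (ht : t ∈ Set.Icc (0 : ℝ) 1) : p i + t • (x - p i) ∈ S i :=
  (h.mem_upper i _).2 fun b hb => norm_sub_le_of_star ((h.mem_upper i x).1 hx b hb) ht

end IsSandwich

/-- The ray from `p i` leaves the lower region `R i` at `a`, and continues inside the upper region
`S i` at least up to `a + s • (a - p i)`. -/
structure IsGap {E : Type*} [NormedAddCommGroup E] [NormedSpace ℝ E]
    (p : Bool → E) (R S : Bool → Set E) (i : Bool) (a : E) (s : ℝ) : Prop where
  pos : 0 < s
  mem_lower : a ∈ R i
  mem_upper : ∀ u ∈ Set.Ioc 0 s, a + u • (a - p i) ∈ S i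
  notMem_lower : ∀ u ∈ Set.Ioc 0 s, a + u • (a - p i) ∉ R i

theorem norm_add_smul_sub_sub {E : Type*} [NormedAddCommGroup E] [NormedSpace ℝ E] (a p : E)
    {s : ℝ} (hs : 0 ≤ s) : ‖a + s • (a - p) - p‖ = (1 + s) * ‖a - p‖ := by
  rw [← norm_smul_of_nonneg (by positivity)]
  congr 1
  module

section

variable {E : Type*} [NormedAddCommGroup E] [NormedSpace ℝ E] {p : Bool → E} {R S : Bool → Set E}
  {m : ℝ}

theorem IsGap.le_norm {i : Bool} {a : E} {s : ℝ} (ha : IsGap p R S i a s)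
    (hm : ∀ i, ∀ x ∈ S i \ R i, m ≤ ‖x - p i‖) : m ≤ ‖a - p i‖ := by
  have hlim : Tendsto (fun u : ℝ => (1 + u) * ‖a - p i‖) (𝓝[>] 0) (𝓝 ‖a - p i‖) := by
    have : Tendsto (fun u : ℝ => (1 + u) * ‖a - p i‖) (𝓝 0) (𝓝 ((1 + 0) * ‖a - p i‖)) :=
      Continuous.tendsto (by fun_prop) 0
    simpa using this.mono_left nhdsWithin_le_nhds
  refine ge_of_tendsto hlim ?_
  filter_upwards [Ioc_mem_nhdsGT ha.pos] with u hu
  rw [← norm_add_smul_sub_sub a (p i) hu.1.le]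
  exact hm i _ ⟨ha.mem_upper u hu, ha.notMem_lower u hu⟩

theorem IsSandwich.exists_isGap (h : IsSandwich p R S) (hm0 : 0 < m)
    (hm : ∀ i, ∀ x ∈ S i \ R i, m ≤ ‖x - p i‖) {i : Bool} {b : E} (hb : b ∈ S i \ R i) :
    ∃ a s, IsGap p R S i a s ∧ b = a + s • (a - p i) := by
  set T : Set ℝ := Set.Icc 0 1 ∩ (fun t : ℝ => p i + t • (b - p i)) ⁻¹' R i with hT
  have hTc : IsCompact T := isCompact_Icc.inter_right
    ((h.isClosed_lower i).preimage (by fun_prop))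
  have hT0 : (0 : ℝ) ∈ T := ⟨by simp, by simpa using h.site_mem_lower i⟩
  obtain ⟨t, htT, htmax⟩ := hTc.exists_isGreatest ⟨0, hT0⟩
  have hout : ∀ τ ∈ Set.Ioc t 1, p i + τ • (b - p i) ∉ R i := fun τ hτ hR =>
    absurd (htmax ⟨⟨htT.1.1.trans hτ.1.le, hτ.2⟩, hR⟩) (not_le.2 hτ.1)
  have ht1 : t < 1 := by
    refine lt_of_le_of_ne htT.1.2 fun h1 => hb.2 ?_
    simpa [h1] using htT.2
  have hbd : m ≤ t * ‖b - p i‖ := by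
    have hlim : Tendsto (fun u : ℝ => u * ‖b - p i‖) (𝓝[>] t) (𝓝 (t * ‖b - p i‖)) :=
      (Continuous.tendsto (by fun_prop) t).mono_left nhdsWithin_le_nhds
    refine ge_of_tendsto hlim ?_
    filter_upwards [Ioc_mem_nhdsGT ht1] with u hu
    have hu0 : 0 ≤ u := htT.1.1.trans hu.1.le
    have := hm i _ ⟨h.star_upper hb.1 ⟨hu0, hu.2⟩, hout u hu⟩
    rwa [add_sub_cancel_left, norm_smul_of_nonneg hu0] at this
  have ht0 : 0 < t := by
    refine lt_of_le_of_ne htT.1.1 fun h0 => ?_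
    rw [← h0, zero_mul] at hbd
    linarith
  have key : ∀ u : ℝ, p i + t • (b - p i) + u • (p i + t • (b - p i) - p i) =
      p i + (t * (1 + u)) • (b - p i) := fun u => by module
  have hu : ∀ u ∈ Set.Ioc 0 ((1 - t) / t), t * (1 + u) ∈ Set.Ioc t 1 := fun u hu => by
    have h1 : u * t ≤ 1 - t := (le_div_iff₀ ht0).1 hu.2
    have h2 : 0 < t * u := mul_pos ht0 hu.1
    constructor <;> nlinarith
  refine ⟨p i + t • (b - p i), (1 - t) / t, ⟨div_pos (by linarith) ht0, htT.2, fun u hu' => ?_,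
    fun u hu' => ?_⟩, ?_⟩
  · rw [key]
    exact h.star_upper hb.1 ⟨ht0.le.trans (hu u hu').1.le, (hu u hu').2⟩
  · rw [key]
    exact hout _ (hu u hu')
  · rw [key, show t * (1 + (1 - t) / t) = 1 by field_simp; ring]
    module

/-- Points just beyond a each have a witness c in the opposite upper region nearer than the site; as
these points are upper, c is not in the opposite lower region. A limit of witnesses is the far end
of the new gap, with σ = 0 if that limit is a lower point. -/
theorem IsSandwich.exists_step [ProperSpace E] (h : IsSandwich p R S) (hm0 : 0 < m)
    (hm : ∀ i, ∀ x ∈ S i \ R i, m ≤ ‖x - p i‖) {i : Bool} {a : E} {s : ℝ}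
    (ha : IsGap p R S i a s) :
    ∃ b σ, GapStep m (p i) a s (p (!i)) b σ ∧ (0 < σ → IsGap p R S (!i) b σ) := by
  set u : ℕ → ℝ := fun n => s / ((n : ℝ) + 1) with hu
  have hu_mem : ∀ n, u n ∈ Set.Ioc 0 s := fun n =>
    ⟨div_pos ha.pos (by positivity), div_le_self ha.pos.le (by simp)⟩
  have hu_lim : Tendsto u (hyperfilter ℕ : Filter ℕ) (𝓝 0) := by
    have : Tendsto u atTop (𝓝 0) := by
      have := (tendsto_one_div_add_atTop_nhds_zero_nat (𝕜 := ℝ)).const_mul s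
      rw [mul_zero] at this
      exact this.congr fun n => (div_eq_mul_one_div _ _).symm
    exact this.mono_left Nat.hyperfilter_le_atTop
  have hex : ∀ n, ∃ c ∈ S (!i), ‖a + u n • (a - p i) - c‖ < ‖a + u n • (a - p i) - p i‖ := by
    intro n
    have := ha.notMem_lower _ (hu_mem n)
    rw [h.mem_lower] at this
    push Not at this
    exact this
  choose c hcS hclt using hex
  have hcR : ∀ n, c n ∉ R (!i) := fun n hn =>
    absurd ((h.mem_upper i _).1 (ha.mem_upper _ (hu_mem n)) _ hn) (not_le.2 (hclt n))
  have hbound : ∀ n, ‖c n - p i‖ ≤ 2 * ((1 + s) * ‖a - p i‖) := fun n => by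
    have h1 := norm_sub_le_norm_sub_add_norm_sub (c n) (a + u n • (a - p i)) (p i)
    have h2 := hclt n
    rw [norm_sub_rev] at h2
    have h3 := norm_add_smul_sub_sub a (p i) (hu_mem n).1.le
    have h4 : (1 + u n) * ‖a - p i‖ ≤ (1 + s) * ‖a - p i‖ :=
      mul_le_mul_of_nonneg_right (by linarith [(hu_mem n).2]) (norm_nonneg _)
    linarith
  obtain ⟨b, hb⟩ := exists_tendsto_hyperfilter hbound
  have hbS : b ∈ S (!i) := (h.isClosed_upper _).mem_of_tendsto hb (Eventually.of_forall hcS)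
  have hbm : m ≤ ‖b - p (!i)‖ := ge_of_tendsto (hb.sub_const (p (!i))).norm
    (Eventually.of_forall fun n => hm _ _ ⟨hcS n, hcR n⟩)
  have ha_lim : Tendsto (fun n => a + u n • (a - p i)) (hyperfilter ℕ : Filter ℕ) (𝓝 a) := by
    simpa using (hu_lim.smul_const (a - p i)).const_add a
  have hab : ‖a - b‖ = ‖a - p i‖ := le_antisymm
    (le_of_tendsto_of_tendsto' (ha_lim.sub hb).norm (ha_lim.sub_const (p i)).norm
      fun n => (hclt n).le) ((h.mem_lower i a).1 ha.mem_lower b hbS)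
  have hbR : ∀ x ∈ R i, ‖b - p (!i)‖ ≤ ‖b - x‖ := fun x hx =>
    (h.mem_upper (!i) b).1 hbS x (by simpa using hx)
  have hba : ‖b - p (!i)‖ ≤ ‖a - p i‖ := by
    rw [← hab, norm_sub_rev a b]
    exact hbR a ha.mem_lower
  have hseg : ∀ t ∈ Set.Icc (0 : ℝ) 1, m ≤ ‖a + t • (p i - a) - b‖ := fun t ht => by
    have e : a + t • (p i - a) = p i + (1 - t) • (a - p i) := by module
    rw [e, norm_sub_rev]
    exact hbm.trans (hbR _ (h.star_lower ha.mem_lower ⟨by linarith [ht.2], by linarith [ht.1]⟩))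
  have hup : ∀ x ∈ R (!i), (1 + s) * ‖a - p i‖ ≤ ‖a + s • (a - p i) - x‖ := fun x hx => by
    rw [← norm_add_smul_sub_sub a (p i) ha.pos.le]
    exact (h.mem_upper i _).1 (ha.mem_upper s ⟨ha.pos, le_rfl⟩) x hx
  by_cases hbR' : b ∈ R (!i)
  · refine ⟨b, 0, ⟨ha.pos, le_rfl, ha.le_norm hm, hbm, by simpa using hab, by simpa using hba,
      fun t ht => by simpa using hseg t ht, hup b hbR'⟩, fun h0 => absurd h0 (lt_irrefl _)⟩
  · obtain ⟨b', σ, hgap, rfl⟩ := h.exists_isGap hm0 hm ⟨hbS, hbR'⟩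
    refine ⟨b', σ, ⟨ha.pos, hgap.pos.le, ha.le_norm hm, hgap.le_norm hm, hab, ?_, hseg,
      hup b' hgap.mem_lower⟩, fun _ => hgap⟩
    rwa [← norm_add_smul_sub_sub b' _ hgap.pos.le]

end

/-! ### Near-minimal gaps and the contradiction -/

section

variable {E : Type*} [NormedAddCommGroup E] [NormedSpace ℝ E]

theorem GapStep.norm_source_le {m ε : ℝ} {p a q b : E} {s σ : ℝ} (h : GapStep m p a s q b σ)
    (hle : (1 + s) * ‖a - p‖ ≤ m + ε) : ‖a - p‖ ≤ m + ε :=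
  (le_mul_of_one_le_left (norm_nonneg _) (by linarith [h.pos])).trans hle

theorem GapStep.norm_target_le {m ε : ℝ} {p a q b : E} {s σ : ℝ} (h : GapStep m p a s q b σ)
    (hle : (1 + s) * ‖a - p‖ ≤ m + ε) : ‖b - q‖ ≤ m + ε :=
  (le_mul_of_one_le_left (norm_nonneg _) (by linarith [h.nonneg])).trans
    (h.target_le.trans (h.norm_source_le hle))

theorem norm_site_le {E : Type*} [NormedAddCommGroup E] (p : Bool → E) (i : Bool) : ‖p i‖ ≤ ‖p true‖ + ‖p false‖ := by
  cases i <;> simp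

/-- Close to the minimal distance `m`, gap steps do not shrink relative gaps by more than a factor
close to one. -/
theorem SmoothNorm.exists_forall_gapStep [ProperSpace E] (hE : SmoothNorm E) {m : ℝ} (hm : 0 < m)
    (p : Bool → E) {δ : ℝ} (hδ : 0 < δ) (hδ1 : δ ≤ 1) :
    ∃ ε > 0, ∀ i a s b σ, GapStep m (p i) a s (p (!i)) b σ → (1 + s) * ‖a - p i‖ ≤ m + ε →
      (1 - δ) * s < σ := by
  by_contra! hcon
  have hpos : ∀ n : ℕ, 0 < 1 / ((n : ℝ) + 1) := fun n => by positivity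
  choose i a s b σ hstep hle hσ using fun n : ℕ => hcon _ (hpos n)
  have hε : Tendsto (fun n : ℕ => 1 / ((n : ℝ) + 1)) (hyperfilter ℕ : Filter ℕ) (𝓝 0) :=
    tendsto_one_div_add_atTop_nhds_zero_nat.mono_left Nat.hyperfilter_le_atTop
  have hle1 : ∀ n : ℕ, (1 + s n) * ‖a n - p (i n)‖ ≤ m + 1 := fun n => by
    have h1 : 1 / ((n : ℝ) + 1) ≤ 1 := div_le_self zero_le_one (by simp)
    linarith [hle n]
  set C := ‖p true‖ + ‖p false‖
  obtain ⟨P, hP⟩ := exists_tendsto_hyperfilter (u := fun n => p (i n)) (c := 0) (C := C)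
    fun n => by simpa using norm_site_le p (i n)
  obtain ⟨Q, hQ⟩ := exists_tendsto_hyperfilter (u := fun n => p (!(i n))) (c := 0) (C := C)
    fun n => by simpa using norm_site_le p (!(i n))
  obtain ⟨α, hα⟩ := exists_tendsto_hyperfilter (u := a) (c := 0) (C := m + 1 + C) fun n => by
    have h1 := (hstep n).norm_source_le (hle1 n)
    have h2 := norm_site_le p (i n)
    have h3 := norm_le_norm_sub_add (a n) (p (i n))
    rw [sub_zero]
    linarith
  obtain ⟨β, hβ⟩ := exists_tendsto_hyperfilter (u := b) (c := 0) (C := m + 1 + C) fun n => by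
    have h1 := (hstep n).norm_target_le (hle1 n)
    have h2 := norm_site_le p (!(i n))
    have h3 := norm_le_norm_sub_add (b n) (p (!(i n)))
    rw [sub_zero]
    linarith
  -- Ratios at most 1 - δ would give m ≤ (1 - δ)m in the limit.
  obtain ⟨-, -, hβQ, h0, hlim⟩ := GapStep.limit hE hm hstep hle hε hP hQ hα hβ
    (ρ := fun _ => 1 - δ) hσ tendsto_const_nhds
  have h1 : max (fderiv ℝ (fun y : E => ‖y‖) (α - β) (β - Q)) 0 ≤ m :=
    max_le (hβQ ▸ (le_abs_self _).trans (abs_fderiv_norm_le _ _)) hm.le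
  have h2 := mul_le_mul_of_nonneg_left h1 (sub_nonneg.2 hδ1)
  nlinarith

variable {p : Bool → E} {R S : Bool → Set E} {m : ℝ}

/-- Starting from an almost maximal relative gap close to the minimal distance, two consecutive
steps change the relative gap by a factor close to one. -/
theorem IsSandwich.exists_two_steps [ProperSpace E] (hE : SmoothNorm E) (h : IsSandwich p R S)
    (hm0 : 0 < m) (hm : ∀ i, ∀ x ∈ S i \ R i, m ≤ ‖x - p i‖)
    (hinf : ∀ ε > 0, ∃ i, ∃ x ∈ S i \ R i, ‖x - p i‖ < m + ε) {δ : ℝ} (hδ : 0 < δ) (hδ1 : δ < 1) :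
    ∃ i a s b σ c τ, GapStep m (p i) a s (p (!i)) b σ ∧ GapStep m (p (!i)) b σ (p i) c τ ∧
      (1 + s) * ‖a - p i‖ ≤ m + δ ∧ (1 + σ) * ‖b - p (!i)‖ ≤ m + δ ∧
      σ ≤ (1 - δ)⁻¹ * s ∧ τ ≤ ((1 - δ)⁻¹) ^ 2 * σ := by
  obtain ⟨ε₀, hε₀, hgrow⟩ := hE.exists_forall_gapStep hm0 p hδ hδ1.le
  set ε := min ε₀ δ
  have hε : 0 < ε := lt_min hε₀ hδ
  have hδ' : 0 < 1 - δ := by linarith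
  set H : Set ℝ := {s | ∃ i a, IsGap p R S i a s ∧ (1 + s) * ‖a - p i‖ ≤ m + ε}
  have hH0 : ∃ s ∈ H, 0 < s := by
    obtain ⟨i, x, hx, hlt⟩ := hinf ε hε
    obtain ⟨a, s, hgap, rfl⟩ := h.exists_isGap hm0 hm hx
    refine ⟨s, ⟨i, a, hgap, ?_⟩, hgap.pos⟩
    rw [← norm_add_smul_sub_sub a (p i) hgap.pos.le]
    exact hlt.le
  have hHb : BddAbove H := by
    refine ⟨ε / m, ?_⟩
    rintro s ⟨i, a, hgap, hle⟩
    rw [le_div_iff₀ hm0]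
    have := mul_le_mul_of_nonneg_left (hgap.le_norm hm) hgap.pos.le
    have := hgap.le_norm hm
    linarith
  have hG : 0 < sSup H := by
    obtain ⟨s, hs, hs0⟩ := hH0
    exact hs0.trans_le (le_csSup hHb hs)
  obtain ⟨s, ⟨i, a, hgap, hle⟩, hs⟩ := exists_lt_of_lt_csSup (s := H) (b := (1 - δ) * sSup H)
    (by obtain ⟨s, hs, -⟩ := hH0; exact ⟨s, hs⟩) (by nlinarith)
  -- The next two gaps stay in `H`, so σ and τ are at most s / (1 - δ); for τ, the growth bound s <
  -- σ / (1 - δ) supplies the second factor.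
  have hmax : ∀ x ∈ H, (1 - δ) * x ≤ s := fun x hx =>
    (mul_le_mul_of_nonneg_left (le_csSup hHb hx) hδ'.le).trans hs.le
  obtain ⟨b, σ, hab, hb⟩ := h.exists_step hm0 hm hgap
  have hσ := hgrow i a s b σ hab (hle.trans (by simp [ε]))
  have hbgap := hb ((mul_pos hδ' hgap.pos).trans hσ)
  have hble : (1 + σ) * ‖b - p (!i)‖ ≤ m + ε := hab.target_le.trans (hab.norm_source_le hle)
  obtain ⟨c, τ, hbc, hc⟩ := h.exists_step hm0 hm hbgap
  have hτ := hgrow (!i) b σ c τ hbc (hble.trans (by simp [ε]))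
  have hcgap := hc ((mul_pos hδ' hbgap.pos).trans hτ)
  have hcle : (1 + τ) * ‖c - p (!!i)‖ ≤ m + ε := hbc.target_le.trans (hbc.norm_source_le hble)
  have hσs := hmax σ ⟨_, b, hbgap, hble⟩
  have hτs := hmax τ ⟨_, c, hcgap, hcle⟩
  rw [Bool.not_not] at hbc
  refine ⟨i, a, s, b, σ, c, τ, hab, hbc, hle.trans (by simp [ε]), hble.trans (by simp [ε]), ?_, ?_⟩
  · rwa [← div_eq_inv_mul, le_div_iff₀' hδ']
  · rw [inv_pow, ← div_eq_inv_mul, le_div_iff₀' (by positivity), pow_two, mul_assoc]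
    exact (mul_le_mul_of_nonneg_left hτs hδ'.le).trans hσ.le

theorem IsSandwich.lower_eq_upper [ProperSpace E] (hE : SmoothNorm E) (h : IsSandwich p R S) :
    R = S := by
  by_contra hne
  have hex : ∃ i, ∃ x ∈ S i, x ∉ R i := by
    by_contra! hall
    exact hne (funext fun i => (h.subset i).antisymm (hall i))
  set D : Set ℝ := {r | ∃ i, ∃ x ∈ S i \ R i, ‖x - p i‖ = r}
  have hD : D.Nonempty := by
    obtain ⟨i, x, hx⟩ := hex
    exact ⟨_, i, x, hx, rfl⟩
  have hDb : BddBelow D := ⟨0, by rintro _ ⟨i, x, -, rfl⟩; exact norm_nonneg _⟩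
  set m := sInf D
  have hm : ∀ i, ∀ x ∈ S i \ R i, m ≤ ‖x - p i‖ := fun i x hx => csInf_le hDb ⟨i, x, hx, rfl⟩
  have hm0 : 0 < m := by
    obtain ⟨δ, hδ, h1⟩ := h.exists_pos_le true
    obtain ⟨δ', hδ', h2⟩ := h.exists_pos_le false
    refine (lt_min hδ hδ').trans_le (le_csInf hD ?_)
    rintro _ ⟨i, x, hx, rfl⟩
    cases i
    · exact (min_le_right _ _).trans (h2 x hx.2)
    · exact (min_le_left _ _).trans (h1 x hx.2)
  have hinf : ∀ ε > 0, ∃ i, ∃ x ∈ S i \ R i, ‖x - p i‖ < m + ε := fun ε hε => by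
    obtain ⟨_, ⟨i, x, hx, rfl⟩, hlt⟩ := exists_lt_of_csInf_lt hD (lt_add_of_pos_right m hε)
    exact ⟨i, x, hx, hlt⟩
  -- The second 1 keeps δ strictly below 1 at n = 0.
  have hpos : ∀ n : ℕ, 0 < 1 / (((n : ℝ) + 1) + 1) := fun n => by positivity
  have hlt1 : ∀ n : ℕ, 1 / (((n : ℝ) + 1) + 1) < 1 := fun n => by
    rw [div_lt_one (by positivity)]
    have : (0 : ℝ) ≤ n := n.cast_nonneg
    linarith
  choose i a s b σ c τ hab hbc hale hble hσ hτ using fun n : ℕ =>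
    h.exists_two_steps hE hm0 hm hinf (hpos n) (hlt1 n)
  have hδ : Tendsto (fun n : ℕ => 1 / (((n : ℝ) + 1) + 1)) (hyperfilter ℕ : Filter ℕ) (𝓝 0) := by
    have := (tendsto_add_atTop_iff_nat 1).2 (tendsto_one_div_add_atTop_nhds_zero_nat (𝕜 := ℝ))
    refine Tendsto.mono_left ?_ Nat.hyperfilter_le_atTop
    simpa using this
  have hρ : Tendsto (fun n : ℕ => (1 - 1 / (((n : ℝ) + 1) + 1))⁻¹) (hyperfilter ℕ : Filter ℕ)
      (𝓝 1) := by
    simpa using (hδ.const_sub 1).inv₀ (by norm_num)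
  have hρ2 : Tendsto (fun n : ℕ => ((1 - 1 / (((n : ℝ) + 1) + 1))⁻¹) ^ 2)
      (hyperfilter ℕ : Filter ℕ) (𝓝 1) := by
    simpa using hρ.pow 2
  have hale1 : ∀ n, (1 + s n) * ‖a n - p (i n)‖ ≤ m + 1 := fun n => by
    linarith [hale n, hlt1 n]
  have hble1 : ∀ n, (1 + σ n) * ‖b n - p (!(i n))‖ ≤ m + 1 := fun n => by
    linarith [hble n, hlt1 n]
  set C := ‖p true‖ + ‖p false‖
  obtain ⟨P, hP⟩ := exists_tendsto_hyperfilter (u := fun n => p (i n)) (c := 0) (C := C)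
    fun n => by simpa using norm_site_le p (i n)
  obtain ⟨Q, hQ⟩ := exists_tendsto_hyperfilter (u := fun n => p (!(i n))) (c := 0) (C := C)
    fun n => by simpa using norm_site_le p (!(i n))
  obtain ⟨α, hα⟩ := exists_tendsto_hyperfilter (u := a) (c := 0) (C := m + 1 + C) fun n => by
    have h1 := (hab n).norm_source_le (hale1 n)
    have h2 := norm_site_le p (i n)
    have h3 := norm_le_norm_sub_add (a n) (p (i n))
    rw [sub_zero]
    linarith
  obtain ⟨β, hβ⟩ := exists_tendsto_hyperfilter (u := b) (c := 0) (C := m + 1 + C) fun n => by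
    have h1 := (hab n).norm_target_le (hale1 n)
    have h2 := norm_site_le p (!(i n))
    have h3 := norm_le_norm_sub_add (b n) (p (!(i n)))
    rw [sub_zero]
    linarith
  obtain ⟨γ, hγ⟩ := exists_tendsto_hyperfilter (u := c) (c := 0) (C := m + 1 + C) fun n => by
    have h1 := (hbc n).norm_target_le (hble1 n)
    have h2 := norm_site_le p (i n)
    have h3 := norm_le_norm_sub_add (c n) (p (i n))
    rw [sub_zero]
    linarith
  obtain ⟨hαP, hαβ, hβQ, h0, hlim⟩ := GapStep.limit hE hm0 hab hale hδ hP hQ hα hβ hσ hρ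
  obtain ⟨-, hβγ, hγP, h0', hlim'⟩ := GapStep.limit hE hm0 hbc hble hδ hQ hP hβ hγ hτ hρ2
  rw [one_mul] at hlim hlim'
  have hαP0 : fderiv ℝ (fun y : E => ‖y‖) (α - β) (α - P) = 0 := by
    have h1 : max (fderiv ℝ (fun y : E => ‖y‖) (α - β) (β - Q)) 0 ≤ m :=
      max_le (hβQ ▸ (le_abs_self _).trans (abs_fderiv_norm_le _ _)) hm0.le
    linarith
  have hγPm : m ≤ fderiv ℝ (fun y : E => ‖y‖) (β - γ) (γ - P) := by
    have h1 : m ≤ max (fderiv ℝ (fun y : E => ‖y‖) (β - γ) (γ - P)) 0 := by linarith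
    exact (le_max_iff.1 h1).resolve_right (not_le.2 hm0)
  have hβP : 2 * m ≤ ‖β - P‖ := by
    have h1 : fderiv ℝ (fun y : E => ‖y‖) (β - γ) (β - γ) = ‖β - γ‖ :=
      (hE _ (by rw [← norm_pos_iff, hβγ]; exact hm0)).fderiv_norm_self
    have h2 := (le_abs_self _).trans (abs_fderiv_norm_le (β - γ) (β - P))
    rw [← sub_add_sub_cancel β γ P, map_add, h1, hβγ, sub_add_sub_cancel] at h2
    linarith
  have hβα : fderiv ℝ (fun y : E => ‖y‖) (β - α) (α - P) = ‖α - P‖ := by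
    refine hE.fderiv_norm_eq_of_norm_add ?_ ?_
    · rw [← norm_pos_iff, norm_sub_rev, hαβ]; exact hm0
    · rw [sub_add_sub_cancel, norm_sub_rev β α, hαβ, hαP]
      linarith
  rw [← neg_sub α β, fderiv_norm_neg, neg_apply, hαP0, hαP] at hβα
  linarith

end

/-! ### Zone diagrams as fixed points -/

theorem mem_dominance_singleton {E : Type*} [NormedAddCommGroup E] {p x : E} {B : Set E} :
    x ∈ dominance {p} B ↔ ∀ b ∈ B, ‖x - p‖ ≤ ‖x - b‖ := by
  simp [dominance, Metric.le_infEDist, enorm_le_iff_norm_le, edist_eq_enorm_sub]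

theorem dominance_antitone {X : Type*} [MetricSpace X] (A : Set X) :
    Antitone (dominance A) := fun _ _ hBC _ hx =>
  le_trans hx (Metric.infEDist_anti hBC)

theorem isZoneDiagram_pair_iff {X : Type*} [MetricSpace X] {A B : Set X} {R : Fin 2 → Set X} :
    IsZoneDiagram ![A, B] R ↔ R 0 = dominance A (R 1) ∧ R 1 = dominance B (R 0) := by
  have h0 : ⋃ j ∈ {j : Fin 2 | j ≠ 0}, R j = R 1 := by
    ext; simp [Fin.exists_fin_two]
  have h1 : ⋃ j ∈ {j : Fin 2 | j ≠ 1}, R j = R 0 := by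
    ext; simp [Fin.exists_fin_two]
  rw [IsZoneDiagram, funext_iff, Fin.forall_fin_two, Dom, Dom, h0, h1]
  rfl

/-- Two different points of a finite-dimensional space with a smooth norm have a unique zone
diagram. -/
theorem SmoothNorm.existsUnique_isZoneDiagram {E : Type*} [NormedAddCommGroup E] [NormedSpace ℝ E]
    [FiniteDimensional ℝ E] (hE : SmoothNorm E) {p₀ p₁ : E} (hne : p₀ ≠ p₁) :
    ∃! R : Fin 2 → Set E, IsZoneDiagram ![{p₀}, {p₁}] R := by
  have := FiniteDimensional.proper_real E
  let F : Set E →o Set E := ⟨fun X => dominance {p₀} (dominance {p₁} X),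
    (dominance_antitone {p₀}).comp (dominance_antitone {p₁})⟩
  have hlfp : dominance {p₀} (dominance {p₁} F.lfp) = F.lfp := F.map_lfp
  have hgfp : dominance {p₀} (dominance {p₁} F.gfp) = F.gfp := F.map_gfp
  have hsub : F.lfp ⊆ F.gfp := F.lfp_le_gfp
  have hsand : IsSandwich (fun i => cond i p₁ p₀)
      (fun i => cond i (dominance {p₁} F.gfp) F.lfp)
      (fun i => cond i (dominance {p₁} F.lfp) F.gfp) := by
    refine ⟨?_, ?_, ?_, ?_⟩
    · rintro (_ | _)
      · exact hne
      · exact hne.symm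
    · rintro (_ | _) x
      · exact (Set.ext_iff.1 hlfp x).symm.trans mem_dominance_singleton
      · exact mem_dominance_singleton
    · rintro (_ | _) x
      · exact (Set.ext_iff.1 hgfp x).symm.trans mem_dominance_singleton
      · exact mem_dominance_singleton
    · rintro (_ | _)
      · exact hsub
      · exact dominance_antitone _ hsub
  have heq : F.lfp = F.gfp := congrFun (hsand.lower_eq_upper hE) false
  refine ⟨![F.lfp, dominance {p₁} F.lfp], isZoneDiagram_pair_iff.2 ⟨hlfp.symm, rfl⟩, fun R hR => ?_⟩
  obtain ⟨h0, h1⟩ := isZoneDiagram_pair_iff.1 hR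
  have hfix : F (R 0) = R 0 := by
    change dominance {p₀} (dominance {p₁} (R 0)) = R 0
    rw [← h1, ← h0]
  have hR0 : R 0 = F.lfp :=
    (heq ▸ F.le_gfp hfix.ge : R 0 ⊆ F.lfp).antisymm (F.lfp_le_fixed hfix)
  funext j
  fin_cases j
  · exact hR0
  · exact h1.trans (congrArg _ hR0)

theorem theorem3 {E : Type*} [NormedAddCommGroup E] [NormedSpace ℝ E]
    (hdim : Module.finrank ℝ E = 2) (hsmooth : SmoothNorm E)
    (p₀ p₁ : E) (hne : p₀ ≠ p₁) :
    ∃! R : Fin 2 → Set E, IsZoneDiagram ![{p₀}, {p₁}] R := by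
  have : FiniteDimensional ℝ E := Module.finite_of_finrank_eq_succ hdim
  exact hsmooth.existsUnique_isZoneDiagram hne
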